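/- For $f\in L^2(\mathbb{R})$ and the normalized Gaussian window $\phi(x)=2^{1/4}e^{-\pi x^2}$, let $$V_\phi f(\omega,t)=\int_{\mathbb{R}} f(x)\,\overline{\phi(x-t)}\,e^{-2\pi i\omega x}\,dx$$ be the short-time Fourier transform. For a set $E\subseteq[0,\infty)$, let $P_E$ denote Daubechies' localization operator with window $\phi$ and spherically symmetric weight $\chi_E(\omega^2+t^2)$, that is, the bounded linear operator on $L^2(\mathbb{R})$, when it exists (it is then unique), such that $$\langle P_E f,g\rangle=\iint_{\mathbb{R}^2}\chi_E(\omega^2+t^2)\,V_\phi f(\omega,t)\,\overline{V_\phi g(\omega,t)}\,d\omega\,dt\qquad\text{for all } f,g\in L^2(\mathbb{R}),$$ where the integrals converge absolutely. For $s\in[0,1]$ let $$E(s)=\bigcup_{n=0}^{\infty}\tfrac1\pi\,[n,n+s],\qquad\text{and let } C=\frac{e}{e-1}.$$ **Theorem.** For every $s\in[0,1]$ the operator $P_{E(s)}$ exists, and its operator norm satisfies $$(1-e^{-s})\,C\;\le\;\|P_{E(s)}\|_{\mathrm{op}}\;\le\;\min\{Cs,1\}.$$ Moreover, there is $s_0\in(0,1]$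 such that $\|P_{E(s)}\|_{\mathrm{op}}=(1-e^{-s})\,C$ for all $0<s<s_0$. -/

import Mathlib

open MeasureTheory

noncomputable section

namespace TimeFrequency

/-- The Hilbert space `L²(ℝ)` of complex signals, with Lebesgue measure. -/
abbrev L2R : Type := Lp ℂ 2 (volume : Measure ℝ)

/-- The short-time Fourier transform of `f` with window `φ` at the point `(ω, t)`:
`∫ f(x) conj(φ(x - t)) exp(-2πi ω x) dx`. -/
def stft (φ f : ℝ → ℂ) (z : ℝ × ℝ) : ℂ :=
  ∫ x : ℝ, f x * (starRingEnd ℂ) (φ (x - z.2)) *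
    Complex.exp (-(2 * (Real.pi : ℂ) * Complex.I * (z.1 : ℂ) * (x : ℂ)))

/-- The integrand `F(ω,t) · V_φ f(ω,t) · conj(V_φ g(ω,t))` of the sesquilinear functional that
defines the localization operator with weight `F` and window `φ`. -/
def locIntegrand (F : ℝ × ℝ → ℂ) (φ : ℝ → ℂ) (f g : L2R) (z : ℝ × ℝ) : ℂ :=
  F z * stft φ f z * (starRingEnd ℂ) (stft φ g z)

/-- `P` is the operator that represents the sesquilinear functional
`(f, g) ↦ ∬ F · V_φ f · conj(V_φ g) dω dt`. Mathlib's inner product is linear in the second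
variable, so the inner product `⟨P f, g⟩` that is linear in its first variable
is `inner ℂ g (P f)`. -/
def IsLocalizationOperator (F : ℝ × ℝ → ℂ) (φ : ℝ → ℂ) (P : L2R →L[ℂ] L2R) : Prop :=
  ∀ f g : L2R, Integrable (locIntegrand F φ f g) ∧
    inner ℂ g (P f) = ∫ z : ℝ × ℝ, locIntegrand F φ f g z

/-- There is at most one such operator. -/
theorem IsLocalizationOperator.unique {F : ℝ × ℝ → ℂ} {φ : ℝ → ℂ} {P Q : L2R →L[ℂ] L2R}
    (hP : IsLocalizationOperator F φ P) (hQ : IsLocalizationOperator F φ Q) : P = Q := by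
  refine ContinuousLinearMap.ext fun f => ext_inner_left ℂ fun g => ?_
  rw [(hP f g).2, (hQ f g).2]

open Classical in
/-- Daubechies' localization operator with weight `F` and window `φ` (set to `0` when the
sesquilinear functional is not represented by a bounded operator). -/
def localizationOperator (F : ℝ × ℝ → ℂ) (φ : ℝ → ℂ) : L2R →L[ℂ] L2R :=
  if h : ∃ P : L2R →L[ℂ] L2R, IsLocalizationOperator F φ P then h.choose else 0

/-- The normalized Gaussian window `φ(x) = 2^{1/4} exp(-π x²)`. -/
def gaussianWindow (x : ℝ) : ℂ :=
  (((2 : ℝ) ^ (1 / 4 : ℝ) * Real.exp (-Real.pi * x ^ 2) : ℝ) : ℂ)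

/-- The spherically symmetric weight `F(ω, t) = χ_E(ω² + t²)` of a set `E` of
squared radii. -/
def sphericalWeight (E : Set ℝ) (z : ℝ × ℝ) : ℂ :=
  E.indicator (fun _ => (1 : ℂ)) (z.1 ^ 2 + z.2 ^ 2)

/-- `P_E`: the localization operator with Gaussian window and weight `χ_E(ω² + t²)`. -/
def sphericalLocalization (E : Set ℝ) : L2R →L[ℂ] L2R :=
  localizationOperator (sphericalWeight E) gaussianWindow

/-- The equidistant intervals `E(s) = ⋃ₙ (1/π) · [n, n + s]`, `n = 0, 1, 2, …`. -/
def equidistantIntervals (s : ℝ) : Set ℝ :=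
  ⋃ n : ℕ, (fun x : ℝ => 1 / Real.pi * x) '' Set.Icc (n : ℝ) ((n : ℝ) + s)

end TimeFrequency

end

namespace TimeFrequency

/-! Up to a phase, the Gaussian transform of `f` is `exp(-π|z|²/2) H(z)` at `z = ω + it`, with `H`
entire. Expand `H = ∑ a_k z^k`. A radial weight keeps the powers orthogonal on every circle, so the
weighted energy of the transform is `∑ c_k λ_k(E)`. Here `c_k = |a_k|² k!/π^k` does not depend on
`E`, and `λ_k(E)` (`radialMoment`) is the mass that the gamma density `x^k e^{-x}/k!` gives to `πE`.

For `E` the whole line all `λ_k` are 1, so `∑ c_k` is the total energy, which is at most `‖f‖²`.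
Hence `P_E = T*T`, with `T` the transform cut off to the weight, has norm at most `sup λ_k`. The
Gaussian has only the mode `k = 0`, so the norm is at least `λ_0`.

For `E(s)`, `λ_0` is a geometric series with value `(1 - e^{-s})C`. For `k ≥ 1` the density is
unimodal with maximum at most `1/e`, so its sum over a shifted integer lattice is at most its
integral plus its maximum; thus `λ_k ≤ (1 + 1/e)s` (`sum_gammaDensity_le`). Since `1 + 1/e < C`,
this gives the bound `Cs`. Since `λ_0 ~ Cs` as `s → 0`, the mode `k = 0` dominates for small `s`. -/

/-! ### The Gaussian window and its transform as an entire function -/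

/-- The Gaussian Laplace integral `∫ f(x) exp(-π x² + 2π x w) dx`, an entire function of `w`
for `f ∈ L²(ℝ)`. -/
noncomputable def gaussianLaplace (f : ℝ → ℂ) (w : ℂ) : ℂ :=
  ∫ x : ℝ, f x * Complex.exp (-Real.pi * x ^ 2 + 2 * Real.pi * x * w)

theorem memLp_exp_neg_mul_sq {b : ℝ} (hb : 0 < b) :
    MemLp (fun x : ℝ => Real.exp (-b * x ^ 2)) 2 volume := by
  rw [memLp_two_iff_integrable_sq (by fun_prop)]
  have h := integrable_exp_neg_mul_sq (b := 2 * b) (by positivity)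
  refine h.congr (.of_forall fun x => ?_)
  simp only [← Real.exp_nat_mul]
  congr 1
  push_cast
  ring

theorem integrable_norm_mul_exp_neg_mul_sq {f : ℝ → ℂ} (hf : MemLp f 2 volume) {b : ℝ}
    (hb : 0 < b) : Integrable (fun x => ‖f x‖ * Real.exp (-b * x ^ 2)) :=
  hf.norm.integrable_mul (memLp_exp_neg_mul_sq hb)

/-- The factor `1 + 2π|x|` absorbs the `w`-derivative of the kernel, so one bound serves both
integrability and differentiation under the integral. The linear exponent is absorbed by `A|x| ≤ A²
+ x²/4`. -/
theorem norm_gaussianLaplace_kernel_le (R : ℝ) (x : ℝ) (w : ℂ) (hw : ‖w‖ ≤ R) :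
    ‖Complex.exp (-Real.pi * x ^ 2 + 2 * Real.pi * x * w)‖ * (1 + 2 * Real.pi * |x|) ≤
      Real.exp ((2 * Real.pi * (R + 1)) ^ 2) * Real.exp (-(Real.pi / 2) * x ^ 2) := by
  have hpi := Real.pi_gt_three
  have hR : 0 ≤ R := (norm_nonneg w).trans hw
  have h1 : 1 + 2 * Real.pi * |x| ≤ Real.exp (2 * Real.pi * |x|) := by
    linarith [Real.add_one_le_exp (2 * Real.pi * |x|)]
  have h2 : x * w.re ≤ |x| * R := by
    calc x * w.re ≤ |x * w.re| := le_abs_self _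
      _ = |x| * |w.re| := abs_mul _ _
      _ ≤ |x| * R := by gcongr; exact (Complex.abs_re_le_norm w).trans hw
  have hre : (-(Real.pi : ℂ) * x ^ 2 + 2 * Real.pi * x * w).re
      = -Real.pi * x ^ 2 + 2 * Real.pi * (x * w.re) := by
    rw [show (-(Real.pi : ℂ) * x ^ 2 + 2 * Real.pi * x * w) =
      ((-Real.pi * x ^ 2 : ℝ) : ℂ) + ((2 * Real.pi * x : ℝ) : ℂ) * w by push_cast; ring,
      Complex.add_re, Complex.ofReal_re, Complex.re_ofReal_mul]
    ring
  rw [Complex.norm_exp, hre, ← Real.exp_add]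
  calc _ ≤ Real.exp (-Real.pi * x ^ 2 + 2 * Real.pi * (x * w.re)) *
        Real.exp (2 * Real.pi * |x|) := by gcongr
    _ = Real.exp (-Real.pi * x ^ 2 + 2 * Real.pi * (x * w.re) + 2 * Real.pi * |x|) :=
        (Real.exp_add _ _).symm
    _ ≤ _ := by
        apply Real.exp_le_exp.2
        set A := 2 * Real.pi * (R + 1)
        have : 2 * Real.pi * (x * w.re) + 2 * Real.pi * |x| ≤ A * |x| := by
          have : 2 * Real.pi * (x * w.re) ≤ 2 * Real.pi * (|x| * R) := by gcongr
          simp only [A]; linarith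
        have h4 : x ^ 2 = |x| ^ 2 := (sq_abs x).symm
        rw [h4]
        nlinarith [sq_nonneg (A - |x| / 2), sq_nonneg (|x|), sq_nonneg A]

theorem integrable_gaussianLaplace {f : ℝ → ℂ} (hf : MemLp f 2 volume) (w : ℂ) :
    Integrable (fun x : ℝ => f x * Complex.exp (-Real.pi * x ^ 2 + 2 * Real.pi * x * w)) := by
  refine ((integrable_norm_mul_exp_neg_mul_sq hf (b := Real.pi / 2) (by positivity)).const_mul
    (Real.exp ((2 * Real.pi * (‖w‖ + 1)) ^ 2))).mono'
    (hf.1.mul (by fun_prop)) (.of_forall fun x => ?_)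
  have h := norm_gaussianLaplace_kernel_le ‖w‖ x w le_rfl
  have h' : ‖Complex.exp (-Real.pi * x ^ 2 + 2 * Real.pi * x * w)‖ ≤
      Real.exp ((2 * Real.pi * (‖w‖ + 1)) ^ 2) * Real.exp (-(Real.pi / 2) * x ^ 2) := by
    refine le_trans (le_mul_of_one_le_right (norm_nonneg _) ?_) h
    linarith [show 0 ≤ 2 * Real.pi * |x| by positivity]
  rw [norm_mul]
  exact (mul_le_mul_of_nonneg_left h' (norm_nonneg _)).trans_eq (by ring)

theorem differentiable_gaussianLaplace {f : ℝ → ℂ} (hf : MemLp f 2 volume) :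
    Differentiable ℂ (gaussianLaplace f) := by
  intro w₀
  refine (hasDerivAt_integral_of_dominated_loc_of_deriv_le (μ := volume) (s := Metric.ball w₀ 1)
    (F := fun w x => f x * Complex.exp (-Real.pi * x ^ 2 + 2 * Real.pi * x * w))
    (F' := fun w x => f x * (Complex.exp (-Real.pi * x ^ 2 + 2 * Real.pi * x * w) *
      (2 * Real.pi * x)))
    (bound := fun x => Real.exp ((2 * Real.pi * ((‖w₀‖ + 1) + 1)) ^ 2) *
      (‖f x‖ * Real.exp (-(Real.pi / 2) * x ^ 2)))
    (Metric.ball_mem_nhds _ one_pos) (.of_forall fun w => ?_) (integrable_gaussianLaplace hf w₀)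
    ?_ ?_ ?_ ?_).2.differentiableAt
  · exact (integrable_gaussianLaplace hf w).1
  · exact hf.1.mul (by fun_prop)
  · refine .of_forall fun x w hw => ?_
    have hw' : ‖w‖ ≤ ‖w₀‖ + 1 := by
      have : ‖w - w₀‖ < 1 := by simpa [dist_eq_norm] using hw
      have := norm_le_norm_add_norm_sub' w w₀
      linarith
    have h := norm_gaussianLaplace_kernel_le (‖w₀‖ + 1) x w hw'
    have h2 : ‖(2 * Real.pi * x : ℂ)‖ ≤ 1 + 2 * Real.pi * |x| := by
      simp [abs_of_pos Real.pi_pos]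
    rw [norm_mul, norm_mul]
    calc _ ≤ ‖f x‖ * (‖Complex.exp (-Real.pi * x ^ 2 + 2 * Real.pi * x * w)‖ *
          (1 + 2 * Real.pi * |x|)) := by gcongr
      _ ≤ _ := (mul_le_mul_of_nonneg_left h (norm_nonneg _)).trans_eq (by ring)
  · exact (integrable_norm_mul_exp_neg_mul_sq hf (by positivity)).const_mul _
  · refine .of_forall fun x w _ => ?_
    have h : HasDerivAt (fun w : ℂ => -(Real.pi : ℂ) * x ^ 2 + 2 * Real.pi * x * w)
        (2 * Real.pi * x : ℂ) w := by
      simpa using HasDerivAt.const_add (-(Real.pi : ℂ) * (x : ℂ) ^ 2)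
        (HasDerivAt.const_mul (2 * Real.pi * x : ℂ) (hasDerivAt_id w))
    exact h.cexp.const_mul (f x)

theorem conj_gaussianWindow_mul_exp (ω t x : ℝ) :
    (starRingEnd ℂ) (gaussianWindow (x - t)) *
        Complex.exp (-(2 * (Real.pi : ℂ) * Complex.I * (ω : ℂ) * (x : ℂ))) =
      ((2 : ℝ) ^ (1 / 4 : ℝ) * Real.exp (-Real.pi * t ^ 2) : ℝ) *
        Complex.exp (-Real.pi * x ^ 2 + 2 * Real.pi * x * (t - ω * Complex.I)) := by
  rw [gaussianWindow, Complex.conj_ofReal]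
  push_cast
  rw [mul_assoc _ (Complex.exp _), mul_assoc _ (Complex.exp _), ← Complex.exp_add,
    ← Complex.exp_add]
  congr 2
  ring

theorem stft_gaussianWindow_eq (f : ℝ → ℂ) (ω t : ℝ) :
    stft gaussianWindow f (ω, t) =
      ((2 : ℝ) ^ (1 / 4 : ℝ) * Real.exp (-Real.pi * t ^ 2) : ℝ) *
        gaussianLaplace f (t - ω * Complex.I) := by
  rw [stft, gaussianLaplace, ← integral_const_mul]
  refine integral_congr_ae (.of_forall fun x => ?_)
  simp only []
  rw [mul_assoc, conj_gaussianWindow_mul_exp]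
  ring

theorem continuous_stft_gaussianWindow {f : ℝ → ℂ} (hf : MemLp f 2 volume) :
    Continuous (stft gaussianWindow f) := by
  have h : stft gaussianWindow f = fun z : ℝ × ℝ =>
      (((2 : ℝ) ^ (1 / 4 : ℝ) * Real.exp (-Real.pi * z.2 ^ 2) : ℝ) : ℂ) *
        gaussianLaplace f (z.2 - z.1 * Complex.I) := by
    ext z
    exact stft_gaussianWindow_eq f z.1 z.2
  rw [h]
  have := (differentiable_gaussianLaplace hf).continuous
  fun_prop

theorem integrable_stft_gaussianWindow {f : ℝ → ℂ} (hf : MemLp f 2 volume) (z : ℝ × ℝ) :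
    Integrable (fun x : ℝ => f x * (starRingEnd ℂ) (gaussianWindow (x - z.2)) *
      Complex.exp (-(2 * (Real.pi : ℂ) * Complex.I * (z.1 : ℂ) * (x : ℂ)))) := by
  refine ((integrable_gaussianLaplace hf (z.2 - z.1 * Complex.I)).const_mul
    (((2 : ℝ) ^ (1 / 4 : ℝ) * Real.exp (-Real.pi * z.2 ^ 2) : ℝ) : ℂ)).congr
    (.of_forall fun x => ?_)
  simp only []
  rw [mul_assoc (f x), conj_gaussianWindow_mul_exp]
  ring

/-- With `z = ω + it` the Laplace variable is `t - iω = -iz`. The factor `exp(πz²/2)` has modulus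
`exp(π(ω² - t²)/2)`, which turns the non-radial `exp(-πt²)` into the radial `exp(-π|z|²/2)`. -/
theorem exists_entire_norm_stft_gaussianWindow {f : ℝ → ℂ} (hf : MemLp f 2 volume) :
    ∃ H : ℂ → ℂ, Differentiable ℂ H ∧ ∀ ω t : ℝ, ‖stft gaussianWindow f (ω, t)‖ =
      Real.exp (-(Real.pi / 2) * (ω ^ 2 + t ^ 2)) * ‖H (ω + t * Complex.I)‖ := by
  refine ⟨fun z => ((2 : ℝ) ^ (1 / 4 : ℝ) : ℝ) *
    Complex.exp (Real.pi / 2 * z ^ 2) * gaussianLaplace f (-Complex.I * z), ?_, fun ω t => ?_⟩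
  · have := differentiable_gaussianLaplace hf
    fun_prop
  · have h1 : -Complex.I * (ω + t * Complex.I) = t - ω * Complex.I := by
      ring_nf; rw [Complex.I_sq]; ring
    have h2 : ((Real.pi / 2 : ℂ) * (ω + t * Complex.I) ^ 2).re
        = Real.pi / 2 * (ω ^ 2 - t ^ 2) := by
      rw [show (Real.pi / 2 : ℂ) = ((Real.pi / 2 : ℝ) : ℂ) by push_cast; rfl,
        Complex.re_ofReal_mul]
      congr 1
      simp [pow_two]
    simp only []
    rw [stft_gaussianWindow_eq, h1, norm_mul, norm_mul, norm_mul, Complex.norm_exp, h2,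
      Complex.norm_real, Complex.norm_real, norm_mul, Real.norm_of_nonneg (Real.exp_pos _).le,
      show -Real.pi * t ^ 2 = -(Real.pi / 2) * (ω ^ 2 + t ^ 2) + Real.pi / 2 * (ω ^ 2 - t ^ 2) by
        ring, Real.exp_add]
    ring

theorem integral_norm_gaussianWindow_sub_sq (t : ℝ) :
    ∫ x, ‖gaussianWindow (x - t)‖ ^ 2 = 1 := by
  rw [integral_sub_right_eq_self (fun x => ‖gaussianWindow x‖ ^ 2)]
  have h : ∀ x : ℝ, ‖gaussianWindow x‖ ^ 2 =
      (2 : ℝ) ^ (1 / 2 : ℝ) * Real.exp (-(2 * Real.pi) * x ^ 2) := by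
    intro x
    rw [gaussianWindow, Complex.norm_real, Real.norm_of_nonneg (by positivity), mul_pow,
      ← Real.exp_nat_mul, ← Real.rpow_natCast, ← Real.rpow_mul (by norm_num)]
    congr 1
    · norm_num
    · congr 1; push_cast; ring
  simp_rw [h]
  rw [integral_const_mul, integral_gaussian, ← Real.sqrt_eq_rpow, ← Real.sqrt_mul (by norm_num),
    show 2 * (Real.pi / (2 * Real.pi)) = 1 by field_simp, Real.sqrt_one]

theorem continuous_gaussianWindow : Continuous gaussianWindow := by
  unfold gaussianWindow
  fun_prop

theorem memLp_gaussianWindow_sub (t : ℝ) :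
    MemLp (fun x => gaussianWindow (x - t)) 2 volume := by
  have hc := continuous_gaussianWindow
  rw [memLp_two_iff_integrable_sq_norm (by fun_prop)]
  -- A non-integrable function would have integral 0 by convention; this one has integral 1.
  exact Integrable.of_integral_ne_zero (by rw [integral_norm_gaussianWindow_sub_sq]; norm_num)

/-! ### Power series on circles -/

theorem integral_cexp_int_mul_I (m : ℤ) :
    ∫ θ in Set.Ioo (-Real.pi) Real.pi, Complex.exp (m * θ * Complex.I) =
      if m = 0 then 2 * (Real.pi : ℂ) else 0 := by
  have hpi := Real.pi_pos
  rw [← integral_Ioc_eq_integral_Ioo, ← intervalIntegral.integral_of_le (by linarith)]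
  split_ifs with h
  · subst h
    simp
    ring
  · have h0 : (m * Complex.I : ℂ) ≠ 0 := by simp [h]
    have h1 := integral_exp_mul_complex (a := -Real.pi) (b := Real.pi) h0
    have h2 : Complex.exp (m * Complex.I * (Real.pi : ℝ)) =
        Complex.exp (m * Complex.I * ((-Real.pi : ℝ) : ℂ)) := by
      rw [Complex.exp_eq_exp_iff_exists_int]
      exact ⟨m, by push_cast; ring⟩
    rw [h2, sub_self, zero_div] at h1
    rw [← h1]
    refine intervalIntegral.integral_congr fun θ _ => ?_
    ring_nf

/-- Termwise integration of a power series on a circle against a continuous function. -/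
theorem hasSum_integral_circle_mul {F : ℂ → ℂ} {a : ℕ → ℂ}
    (ha : ∀ z, HasSum (fun k => a k * z ^ k) (F z)) (r : ℝ) {h : ℝ → ℂ} (hh : Continuous h) :
    HasSum (fun k : ℕ => a k * r ^ k *
        ∫ θ in Set.Ioo (-Real.pi) Real.pi, Complex.exp (k * θ * Complex.I) * h θ)
      (∫ θ in Set.Ioo (-Real.pi) Real.pi, F (r * Complex.exp (θ * Complex.I)) * h θ) := by
  have hint : ∀ k : ℕ, Integrable (fun θ : ℝ => a k * r ^ k *
      (Complex.exp (k * θ * Complex.I) * h θ))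
      (volume.restrict (Set.Ioo (-Real.pi) Real.pi)) := fun k =>
    ((Continuous.integrableOn_Icc (by fun_prop)).mono_set Set.Ioo_subset_Icc_self :
      IntegrableOn _ _ _)
  have hnorm : ∀ (k : ℕ) (θ : ℝ), ‖a k * r ^ k * (Complex.exp (k * θ * Complex.I) * h θ)‖ =
      ‖a k * r ^ k‖ * ‖h θ‖ := by
    intro k θ
    rw [norm_mul, norm_mul (Complex.exp _), show (k * θ * Complex.I : ℂ) =
      ((k * θ : ℝ) : ℂ) * Complex.I by push_cast; ring, Complex.norm_exp_ofReal_mul_I, one_mul]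
  have h1 := hasSum_integral_of_summable_integral_norm hint (by
    simp_rw [hnorm, integral_const_mul]
    exact ((ha r).summable.norm).mul_right _)
  simp_rw [integral_const_mul] at h1
  convert! h1 using 1
  refine integral_congr_ae (.of_forall fun θ => ?_)
  simp only []
  rw [← (ha (r * Complex.exp (θ * Complex.I))).tsum_eq, ← tsum_mul_right]
  refine tsum_congr fun k => ?_
  rw [mul_pow, ← Complex.exp_nat_mul]
  ring_nf

theorem integral_circle_mul_cexp_neg {F : ℂ → ℂ} {a : ℕ → ℂ}
    (ha : ∀ z, HasSum (fun k => a k * z ^ k) (F z)) (r : ℝ) (j : ℕ) :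
    ∫ θ in Set.Ioo (-Real.pi) Real.pi, F (r * Complex.exp (θ * Complex.I)) *
      Complex.exp (-(j * θ * Complex.I)) = 2 * Real.pi * (a j * r ^ j) := by
  refine (hasSum_integral_circle_mul ha r (by fun_prop)).unique ?_
  convert! hasSum_ite_eq j (2 * (Real.pi : ℂ) * (a j * r ^ j)) using 2 with k
  have := integral_cexp_int_mul_I (k - j)
  simp_rw [← Complex.exp_add]
  rw [show (∫ θ in Set.Ioo (-Real.pi) Real.pi,
      Complex.exp (k * θ * Complex.I + -(j * θ * Complex.I))) = _ from
    (integral_congr_ae (.of_forall fun θ => by push_cast; ring_nf)).trans this]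
  by_cases hk : k = j
  · subst hk; simp; ring
  · have : (k : ℤ) - j ≠ 0 := by omega
    simp [hk, this]

/-- Parseval's identity on circles for an everywhere convergent power series. -/
theorem hasSum_sq_norm_circle {F : ℂ → ℂ} (hF : Continuous F) {a : ℕ → ℂ}
    (ha : ∀ z, HasSum (fun k => a k * z ^ k) (F z)) (r : ℝ) :
    HasSum (fun k : ℕ => 2 * Real.pi * (‖a k‖ ^ 2 * r ^ (2 * k)))
      (∫ θ in Set.Ioo (-Real.pi) Real.pi, ‖F (r * Complex.exp (θ * Complex.I))‖ ^ 2) := by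
  -- Pair `F` with its own conjugate: each termwise integral is then the conjugate of a coefficient
  -- integral.
  have h := hasSum_integral_circle_mul ha r
    (h := fun θ => (starRingEnd ℂ) (F (r * Complex.exp (θ * Complex.I))))
    (Complex.continuous_conj.comp (by fun_prop))
  rw [← Complex.hasSum_ofReal, ← integral_complex_ofReal]
  convert! h using 2 with k
  · have h1 : ∀ θ : ℝ, Complex.exp (k * θ * Complex.I) *
        (starRingEnd ℂ) (F (r * Complex.exp (θ * Complex.I))) =
        (starRingEnd ℂ) (F (r * Complex.exp (θ * Complex.I)) *
          Complex.exp (-(k * θ * Complex.I))) := by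
      intro θ
      rw [map_mul, ← Complex.exp_conj, mul_comm]
      simp
    simp_rw [h1]
    rw [integral_conj, integral_circle_mul_cexp_neg ha]
    have := Complex.mul_conj' (a k)
    simp only [map_mul, map_pow, Complex.conj_ofReal, map_ofNat]
    push_cast
    linear_combination (-(2 * Real.pi * (r : ℂ) ^ (2 * k))) * this
  · ext θ
    rw [Complex.mul_conj']
    push_cast
    rfl

theorem exists_hasSum_pow_of_differentiable {F : ℂ → ℂ} (hF : Differentiable ℂ F) :
    ∃ a : ℕ → ℂ, ∀ z, HasSum (fun k => a k * z ^ k) (F z) := by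
  refine ⟨fun k => ((k.factorial : ℂ)⁻¹ * iteratedDeriv k F 0), fun z => ?_⟩
  convert! Complex.hasSum_taylorSeries_of_entire hF 0 z using 2 with k
  simp
  ring

theorem lintegral_sq_norm_circle {F : ℂ → ℂ} (hc : Continuous F) {a : ℕ → ℂ}
    (ha : ∀ z, HasSum (fun k => a k * z ^ k) (F z)) (r : ℝ) :
    ∫⁻ θ in Set.Ioo (-Real.pi) Real.pi,
        ENNReal.ofReal (‖F ((r * Real.cos θ : ℝ) + (r * Real.sin θ : ℝ) * Complex.I)‖ ^ 2) =
      ∑' k : ℕ, ENNReal.ofReal (2 * Real.pi * (‖a k‖ ^ 2 * r ^ (2 * k))) := by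
  have hs := hasSum_sq_norm_circle hc ha r
  have hz : ∀ θ : ℝ, (((r * Real.cos θ : ℝ) : ℂ) + (r * Real.sin θ : ℝ) * Complex.I) =
      r * Complex.exp (θ * Complex.I) := by
    intro θ
    rw [Complex.exp_mul_I]
    push_cast
    ring
  simp_rw [hz]
  rw [← ofReal_integral_eq_lintegral_ofReal _ (.of_forall fun θ => by positivity), ← hs.tsum_eq,
    ENNReal.ofReal_tsum_of_nonneg (fun k => ?_) hs.summable]
  · rw [pow_mul]; positivity
  · have hc' : Continuous fun θ : ℝ => ‖F (r * Complex.exp (θ * Complex.I))‖ ^ 2 := by fun_prop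
    exact hc'.integrableOn_Icc.mono_set Set.Ioo_subset_Icc_self

/-! ### Radial weights in polar coordinates -/

/-- The density `x^k exp(-x) / k!` of the gamma distribution with shape `k + 1`. -/
noncomputable def gammaDensity (k : ℕ) (x : ℝ) : ℝ :=
  x ^ k * Real.exp (-x) / k.factorial

/-- The eigenvalue `∫_{x > 0, x/π ∈ E} x^k exp(-x) / k! dx` of the localization operator `P_E`
on the `k`-th Hermite function. -/
noncomputable def radialMoment (E : Set ℝ) (k : ℕ) : ENNReal :=
  ∫⁻ x in Set.Ioi (0 : ℝ), E.indicator 1 (x / Real.pi) *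
    ENNReal.ofReal (gammaDensity k x)

/-- The substitution `x = πr²`, under which the radial Gaussian integrals become gamma integrals. -/
theorem lintegral_Ioi_comp_pi_mul_sq (g : ℝ → ENNReal) :
    ∫⁻ r in Set.Ioi (0 : ℝ), ENNReal.ofReal (2 * Real.pi * r) * g (Real.pi * r ^ 2) =
      ∫⁻ x in Set.Ioi (0 : ℝ), g x := by
  have hpi := Real.pi_pos
  have himg : (fun r : ℝ => Real.pi * r ^ 2) '' Set.Ioi 0 = Set.Ioi 0 := by
    ext x
    simp only [Set.mem_image, Set.mem_Ioi]
    constructor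
    · rintro ⟨r, hr, rfl⟩
      positivity
    · intro hx
      refine ⟨√(x / Real.pi), by positivity, ?_⟩
      rw [Real.sq_sqrt (by positivity)]
      field_simp
  have h := lintegral_image_eq_lintegral_abs_deriv_mul (s := Set.Ioi (0 : ℝ)) measurableSet_Ioi
    (f := fun r : ℝ => Real.pi * r ^ 2) (f' := fun r => 2 * Real.pi * r) (fun x _ => ?_) ?_ g
  · rw [himg] at h
    rw [h]
    refine setLIntegral_congr_fun measurableSet_Ioi fun r hr => ?_
    simp only [Set.mem_Ioi] at hr
    rw [abs_of_pos (by positivity)]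
  · have := ((hasDerivAt_pow 2 x).const_mul Real.pi).hasDerivWithinAt (s := Set.Ioi 0)
    convert! this using 1
    simp
    ring
  · intro x hx y hy hxy
    simp only [Set.mem_Ioi] at hx hy
    exact (sq_eq_sq₀ hx.le hy.le).1 (mul_left_cancel₀ hpi.ne' hxy)

/-- In polar coordinates the weight depends on the radius alone, so Parseval on each circle removes
the cross terms. All terms are nonnegative, so the sum and the radial integral commute. The
coefficients on the right are free of `E`, which lets different sets be compared for the same
function. -/
theorem lintegral_radial_mul_sq_norm {V : ℝ × ℝ → ℂ} {H : ℂ → ℂ} (hcH : Continuous H)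
    (hV : ∀ ω t : ℝ, ‖V (ω, t)‖ =
      Real.exp (-(Real.pi / 2) * (ω ^ 2 + t ^ 2)) * ‖H (ω + t * Complex.I)‖)
    {a : ℕ → ℂ} (ha : ∀ z, HasSum (fun k => a k * z ^ k) (H z))
    {E : Set ℝ} (hE : MeasurableSet E) :
    ∫⁻ z : ℝ × ℝ, E.indicator 1 (z.1 ^ 2 + z.2 ^ 2) * ENNReal.ofReal (‖V z‖ ^ 2) =
      ∑' k, ENNReal.ofReal (‖a k‖ ^ 2 * k.factorial / Real.pi ^ k) * radialMoment E k := by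
  have hpi := Real.pi_pos
  have hind : Measurable (E.indicator (1 : ℝ → ENNReal)) := measurable_one.indicator hE
  set W : ℝ → ENNReal := fun r => ENNReal.ofReal r *
    (E.indicator 1 (r ^ 2) * ENNReal.ofReal (Real.exp (-Real.pi * r ^ 2))) with hW
  have hWm : Measurable W := by
    have : Measurable fun r : ℝ => E.indicator (1 : ℝ → ENNReal) (r ^ 2) :=
      hind.comp (by fun_prop)
    simp only [hW]
    fun_prop
  have hpol : ∀ r θ : ℝ, ENNReal.ofReal r • (fun z : ℝ × ℝ =>
      E.indicator (1 : ℝ → ENNReal) (z.1 ^ 2 + z.2 ^ 2) *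
        ENNReal.ofReal (‖V z‖ ^ 2)) (polarCoord.symm (r, θ)) =
      W r * ENNReal.ofReal
        (‖H ((r * Real.cos θ : ℝ) + (r * Real.sin θ : ℝ) * Complex.I)‖ ^ 2) := by
    intro r θ
    have h1 : (r * Real.cos θ) ^ 2 + (r * Real.sin θ) ^ 2 = r ^ 2 := by
      linear_combination r ^ 2 * Real.sin_sq_add_cos_sq θ
    simp only [polarCoord_symm_apply, smul_eq_mul, hW]
    rw [hV, h1, mul_pow, ENNReal.ofReal_mul (by positivity), ← Real.exp_nat_mul]
    rw [show ((2 : ℕ) : ℝ) * (-(Real.pi / 2) * r ^ 2) = -Real.pi * r ^ 2 by push_cast; ring]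
    ring
  rw [← lintegral_comp_polarCoord_symm]
  rw [polarCoord_target, Measure.volume_eq_prod, ← Measure.prod_restrict]
  refine (lintegral_congr fun p : ℝ × ℝ => hpol p.1 p.2).trans ?_
  rw [lintegral_prod _ (by fun_prop)]
  have hcirc : ∀ r : ℝ, ∫⁻ θ in Set.Ioo (-Real.pi) Real.pi, W r * ENNReal.ofReal
      (‖H ((r * Real.cos θ : ℝ) + (r * Real.sin θ : ℝ) * Complex.I)‖ ^ 2) =
      ∑' k : ℕ, W r * ENNReal.ofReal (2 * Real.pi * (‖a k‖ ^ 2 * r ^ (2 * k))) := by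
    intro r
    rw [lintegral_const_mul _ (by fun_prop), lintegral_sq_norm_circle hcH ha, ENNReal.tsum_mul_left]
  simp_rw [hcirc]
  rw [lintegral_tsum fun k => by fun_prop]
  refine tsum_congr fun k => ?_
  rw [radialMoment, ← lintegral_const_mul']
  swap
  · exact ENNReal.ofReal_ne_top
  conv_rhs => rw [← lintegral_Ioi_comp_pi_mul_sq]
  refine setLIntegral_congr_fun measurableSet_Ioi fun r hr => ?_
  simp only [Set.mem_Ioi] at hr
  simp only [hW, gammaDensity]
  rw [mul_div_cancel_left₀ _ hpi.ne', mul_left_comm (ENNReal.ofReal (_ / _)),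
    ← ENNReal.ofReal_mul (by positivity), mul_left_comm (ENNReal.ofReal r),
    ← ENNReal.ofReal_mul (by positivity), mul_left_comm (ENNReal.ofReal _),
    ← ENNReal.ofReal_mul (by positivity), mul_assoc, ← ENNReal.ofReal_mul (by positivity)]
  congr 2
  rw [mul_pow, ← pow_mul, neg_mul]
  field_simp

/-! ### The transform as a contraction -/

theorem stft_congr_ae {φ f g : ℝ → ℂ} (h : f =ᵐ[volume] g) : stft φ f = stft φ g := by
  ext z
  refine integral_congr_ae ?_
  filter_upwards [h] with x hx
  rw [hx]

theorem stft_gaussianWindow_add {f g : ℝ → ℂ} (hf : MemLp f 2 volume) (hg : MemLp g 2 volume)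
    (z : ℝ × ℝ) : stft gaussianWindow (f + g) z =
      stft gaussianWindow f z + stft gaussianWindow g z := by
  unfold stft
  rw [← integral_add (integrable_stft_gaussianWindow hf z) (integrable_stft_gaussianWindow hg z)]
  refine integral_congr_ae (.of_forall fun x => ?_)
  simp only [Pi.add_apply]
  ring

theorem stft_const_smul (φ f : ℝ → ℂ) (c : ℂ) (z : ℝ × ℝ) :
    stft φ (c • f) z = c * stft φ f z := by
  unfold stft
  rw [← integral_const_mul]
  refine integral_congr_ae (.of_forall fun x => ?_)
  simp only [Pi.smul_apply, smul_eq_mul]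
  ring

theorem integral_sq_norm_eq_sq_norm {α : Type*} [MeasurableSpace α] {μ : Measure α}
    (f : Lp ℂ 2 μ) : ∫ x, ‖f x‖ ^ 2 ∂μ = ‖f‖ ^ 2 := by
  have := L2.inner_def (𝕜 := ℂ) f f
  simp only [inner_self_eq_norm_sq_to_K] at this
  apply Complex.ofReal_injective
  rw [← integral_complex_ofReal]
  push_cast
  simpa using this.symm

/-- Cauchy–Schwarz against a window of norm one. It gives pointwise convergence of transforms under
`L²` convergence. -/
theorem norm_stft_gaussianWindow_le (f : L2R) (z : ℝ × ℝ) :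
    ‖stft gaussianWindow f z‖ ≤ ‖f‖ := by
  have hφ := memLp_gaussianWindow_sub z.2
  have hn : ∀ x : ℝ, ‖f x * (starRingEnd ℂ) (gaussianWindow (x - z.2)) *
      Complex.exp (-(2 * (Real.pi : ℂ) * Complex.I * (z.1 : ℂ) * (x : ℂ)))‖ =
      ‖f x‖ * ‖gaussianWindow (x - z.2)‖ := by
    intro x
    rw [norm_mul, norm_mul, RCLike.norm_conj, show -(2 * (Real.pi : ℂ) * Complex.I * z.1 * x) =
      ((-(2 * Real.pi * z.1 * x) : ℝ) : ℂ) * Complex.I by push_cast; ring,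
      Complex.norm_exp_ofReal_mul_I, mul_one]
  calc ‖stft gaussianWindow f z‖ ≤ ∫ x, ‖f x‖ * ‖gaussianWindow (x - z.2)‖ := by
        refine (norm_integral_le_integral_norm _).trans_eq ?_
        simp_rw [hn]
    _ ≤ (∫ x, ‖f x‖ ^ (2 : ℝ)) ^ (1 / (2 : ℝ)) *
        (∫ x, ‖gaussianWindow (x - z.2)‖ ^ (2 : ℝ)) ^ (1 / (2 : ℝ)) :=
      integral_mul_norm_le_Lp_mul_Lq .two_two (by simpa using Lp.memLp f) (by simpa using hφ)
    _ = ‖f‖ := by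
      simp_rw [Real.rpow_two, integral_sq_norm_eq_sq_norm, integral_norm_gaussianWindow_sub_sq, Real.one_rpow, mul_one]
      rw [← Real.sqrt_eq_rpow, Real.sqrt_sq (norm_nonneg _)]

theorem contDiff_gaussianWindow : ContDiff ℝ (⊤ : ℕ∞) gaussianWindow := by
  unfold gaussianWindow
  have h : ContDiff ℝ (⊤ : ℕ∞) fun x : ℝ => Real.exp (-Real.pi * x ^ 2) := by fun_prop
  exact Complex.ofRealCLM.contDiff.comp (contDiff_const.mul h)

theorem lintegral_sq_norm_gaussianWindow_sub (x : ℝ) :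
    ∫⁻ t, ENNReal.ofReal (‖gaussianWindow (x - t)‖ ^ 2) = 1 := by
  rw [lintegral_sub_left_eq_self (fun t => ENNReal.ofReal (‖gaussianWindow t‖ ^ 2)),
    ← ofReal_integral_eq_lintegral_ofReal _ (.of_forall fun _ => by positivity)]
  · have := integral_norm_gaussianWindow_sub_sq 0
    simp only [sub_zero] at this
    simp [this]
  · have := memLp_gaussianWindow_sub 0
    simp only [sub_zero] at this
    exact (memLp_two_iff_integrable_sq_norm this.1).1 this

/-- Plancherel's identity in the frequency variable at a fixed time. -/
theorem lintegral_sq_norm_stft_fst {g : ℝ → ℂ} (hg : HasCompactSupport g)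
    (hg' : ContDiff ℝ (⊤ : ℕ∞) g) (t : ℝ) :
    ∫⁻ ω, ENNReal.ofReal (‖stft gaussianWindow g (ω, t)‖ ^ 2) =
      ∫⁻ x, ENNReal.ofReal (‖g x‖ ^ 2) * ENNReal.ofReal (‖gaussianWindow (x - t)‖ ^ 2) := by
  have h1 : HasCompactSupport fun x => g x * (starRingEnd ℂ) (gaussianWindow (x - t)) :=
    hg.mul_right
  have h2 : ContDiff ℝ (⊤ : ℕ∞) fun x => g x * (starRingEnd ℂ) (gaussianWindow (x - t)) :=
    hg'.mul (Complex.conjCLE.contDiff.comp (contDiff_gaussianWindow.comp (by fun_prop)))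
  -- The windowed signal is smooth with compact support, hence Schwartz, and its Fourier transform
  -- is the slice at time `t`.
  set S : SchwartzMap ℝ ℂ := h1.toSchwartzMap h2 with hS
  have hSx : ∀ x, S x = g x * (starRingEnd ℂ) (gaussianWindow (x - t)) := fun x => rfl
  have hF : ∀ ω, stft gaussianWindow g (ω, t) = FourierTransform.fourier S ω := by
    intro ω
    rw [SchwartzMap.fourier_coe, Real.fourier_real_eq_integral_exp_smul]
    refine integral_congr_ae (.of_forall fun x => ?_)
    simp only [hSx, smul_eq_mul]
    rw [mul_comm]
    congr 2
    push_cast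
    ring
  have hP := SchwartzMap.integral_norm_sq_fourier S
  have hi : ∀ T : SchwartzMap ℝ ℂ, Integrable fun x => ‖T x‖ ^ 2 := fun T =>
    (memLp_two_iff_integrable_sq_norm T.continuous.aestronglyMeasurable).1 (T.memLp 2)
  simp_rw [hF]
  rw [← ofReal_integral_eq_lintegral_ofReal (hi _) (.of_forall fun _ => by positivity), hP,
    ofReal_integral_eq_lintegral_ofReal (hi _) (.of_forall fun _ => by positivity)]
  refine lintegral_congr fun x => ?_
  rw [hSx, norm_mul, mul_pow, RCLike.norm_conj, ENNReal.ofReal_mul (by positivity)]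

/-- Integrate the Plancherel identity over `t`; by Tonelli the translated windows contribute total
mass 1 at each `x`. -/
theorem lintegral_sq_norm_stft_of_hasCompactSupport {g : ℝ → ℂ} (hg : HasCompactSupport g)
    (hg' : ContDiff ℝ (⊤ : ℕ∞) g) :
    ∫⁻ z, ENNReal.ofReal (‖stft gaussianWindow g z‖ ^ 2) =
      ∫⁻ x, ENNReal.ofReal (‖g x‖ ^ 2) := by
  have hgc := hg'.continuous
  have hc := continuous_stft_gaussianWindow (hgc.memLp_of_hasCompactSupport hg)
  have hcw := continuous_gaussianWindow
  rw [Measure.volume_eq_prod, lintegral_prod_symm' _ (by fun_prop)]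
  simp_rw [lintegral_sq_norm_stft_fst hg hg']
  rw [lintegral_lintegral_swap (by fun_prop)]
  refine lintegral_congr fun x => ?_
  rw [lintegral_const_mul _ (by fun_prop), lintegral_sq_norm_gaussianWindow_sub, mul_one]

theorem lintegral_sq_norm_eq_ofReal_sq_norm {α : Type*} [MeasurableSpace α] {μ : Measure α}
    (f : Lp ℂ 2 μ) : ∫⁻ x, ENNReal.ofReal (‖f x‖ ^ 2) ∂μ = ENNReal.ofReal (‖f‖ ^ 2) := by
  rw [← integral_sq_norm_eq_sq_norm,
    ofReal_integral_eq_lintegral_ofReal _ (.of_forall fun _ => by positivity)]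
  exact (memLp_two_iff_integrable_sq_norm (Lp.memLp f).1).1 (Lp.memLp f)

/-- The Gaussian short-time Fourier transform is a contraction from `L²(ℝ)` to `L²(ℝ²)`. -/
theorem lintegral_sq_norm_stft_le (f : L2R) :
    ∫⁻ z, ENNReal.ofReal (‖stft gaussianWindow f z‖ ^ 2) ≤ ENNReal.ofReal (‖f‖ ^ 2) := by
  have hd := MeasureTheory.Lp.dense_hasCompactSupport_contDiff (F := ℂ)
    (μ := (volume : Measure ℝ)) (p := 2) (by norm_num)
  obtain ⟨u, hu, hlim⟩ := mem_closure_iff_seq_limit.1 (hd f)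
  have hpt : ∀ z, Filter.Tendsto (fun n => stft gaussianWindow (u n) z) Filter.atTop
      (nhds (stft gaussianWindow f z)) := by
    intro z
    rw [tendsto_iff_norm_sub_tendsto_zero] at hlim ⊢
    refine squeeze_zero (fun _ => norm_nonneg _) (fun n => ?_) hlim
    have h1 : stft gaussianWindow (u n) z =
        stft gaussianWindow (u n - f : L2R) z + stft gaussianWindow f z := by
      rw [← stft_gaussianWindow_add (Lp.memLp _) (Lp.memLp _)]
      refine congrFun (stft_congr_ae ?_) z
      filter_upwards [Lp.coeFn_sub (u n) f] with x hx
      rw [Pi.add_apply, hx, Pi.sub_apply, sub_add_cancel]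
    rw [h1, add_sub_cancel_right]
    exact norm_stft_gaussianWindow_le _ z
  have heq : ∀ n, ∫⁻ z, ENNReal.ofReal (‖stft gaussianWindow (u n) z‖ ^ 2) =
      ENNReal.ofReal (‖u n‖ ^ 2) := by
    intro n
    obtain ⟨g, hg, hg1, hg2⟩ := hu n
    rw [stft_congr_ae hg, lintegral_sq_norm_stft_of_hasCompactSupport hg1 hg2,
      ← lintegral_sq_norm_eq_ofReal_sq_norm]
    refine lintegral_congr_ae ?_
    filter_upwards [hg] with x hx
    rw [hx]
  -- Fatou's lemma carries the identity from the dense class to `f` as an inequality, and the norm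
  -- bounds need no more.
  calc ∫⁻ z, ENNReal.ofReal (‖stft gaussianWindow f z‖ ^ 2)
      = ∫⁻ z, Filter.liminf (fun n => ENNReal.ofReal (‖stft gaussianWindow (u n) z‖ ^ 2))
          Filter.atTop := by
        refine lintegral_congr fun z => ?_
        exact (ENNReal.tendsto_ofReal ((hpt z).norm.pow 2)).liminf_eq.symm
    _ ≤ Filter.liminf (fun n => ∫⁻ z, ENNReal.ofReal (‖stft gaussianWindow (u n) z‖ ^ 2))
          Filter.atTop := by
        refine lintegral_liminf_le fun n => ?_
        have := continuous_stft_gaussianWindow (Lp.memLp (u n))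
        fun_prop
    _ = ENNReal.ofReal (‖f‖ ^ 2) := by
        simp_rw [heq]
        exact (ENNReal.tendsto_ofReal (hlim.norm.pow 2)).liminf_eq

/-! ### Gamma densities and their lattice sums -/

theorem continuous_gammaDensity (k : ℕ) : Continuous (gammaDensity k) := by
  unfold gammaDensity
  fun_prop

theorem gammaDensity_nonneg (k : ℕ) {x : ℝ} (hx : 0 ≤ x) : 0 ≤ gammaDensity k x := by
  unfold gammaDensity
  positivity

theorem integrableOn_gammaDensity (k : ℕ) : IntegrableOn (gammaDensity k) (Set.Ioi 0) := by
  have h := (Real.GammaIntegral_convergent (s := k + 1) (by positivity)).div_const (k.factorial : ℝ)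
  refine IntegrableOn.congr_fun h (fun x _ => ?_) measurableSet_Ioi
  simp [gammaDensity, mul_comm]

theorem integral_gammaDensity (k : ℕ) : ∫ x in Set.Ioi 0, gammaDensity k x = 1 := by
  have h := Real.Gamma_eq_integral (s := k + 1) (by positivity)
  rw [Real.Gamma_nat_eq_factorial] at h
  simp only [gammaDensity, integral_div]
  rw [div_eq_one_iff_eq (by positivity), h]
  refine setIntegral_congr_fun measurableSet_Ioi fun x _ => ?_
  simp [mul_comm]

theorem radialMoment_univ (k : ℕ) : radialMoment Set.univ k = 1 := by
  simp only [radialMoment, Set.indicator_univ, Pi.one_apply, one_mul]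
  rw [← ofReal_integral_eq_lintegral_ofReal (integrableOn_gammaDensity k), integral_gammaDensity,
    ENNReal.ofReal_one]
  exact (ae_restrict_iff' measurableSet_Ioi).2
    (.of_forall fun x hx => gammaDensity_nonneg k (le_of_lt hx))

theorem radialMoment_le_one (E : Set ℝ) (k : ℕ) : radialMoment E k ≤ 1 := by
  rw [← radialMoment_univ k]
  refine lintegral_mono fun x => ?_
  gcongr
  exact Set.subset_univ E

/-- The factor `m + 1 - x` shows the density to be unimodal with peak at `m + 1`. Shape 0, which
only decreases, is treated separately. -/
theorem hasDerivAt_gammaDensity_succ (m : ℕ) (x : ℝ) :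
    HasDerivAt (gammaDensity (m + 1))
      (((m + 1 : ℝ) - x) * (x ^ m * Real.exp (-x) / (m + 1).factorial)) x := by
  have h := ((hasDerivAt_pow (m + 1) x).mul (hasDerivAt_neg x).exp).div_const
    ((m + 1).factorial : ℝ)
  convert! h using 1
  simp only [Nat.add_sub_cancel]
  push_cast
  ring

theorem monotoneOn_gammaDensity (m : ℕ) :
    MonotoneOn (gammaDensity (m + 1)) (Set.Icc 0 (m + 1 : ℝ)) := by
  refine monotoneOn_of_deriv_nonneg (convex_Icc _ _) (continuous_gammaDensity _).continuousOn
    (fun x _ => (hasDerivAt_gammaDensity_succ m x).differentiableAt.differentiableWithinAt)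
    fun x hx => ?_
  rw [interior_Icc] at hx
  rw [(hasDerivAt_gammaDensity_succ m x).deriv]
  have := hx.1
  exact mul_nonneg (by linarith [hx.2]) (by positivity)

theorem antitoneOn_gammaDensity (m : ℕ) :
    AntitoneOn (gammaDensity (m + 1)) (Set.Ici (m + 1 : ℝ)) := by
  refine antitoneOn_of_deriv_nonpos (convex_Ici _) (continuous_gammaDensity _).continuousOn
    (fun x _ => (hasDerivAt_gammaDensity_succ m x).differentiableAt.differentiableWithinAt)
    fun x hx => ?_
  rw [interior_Ici, Set.mem_Ioi] at hx
  rw [(hasDerivAt_gammaDensity_succ m x).deriv]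
  have : 0 < x := lt_trans (by positivity) hx
  exact mul_nonpos_of_nonpos_of_nonneg (by linarith) (by positivity)

/-- The peak values `k^k e^{-k}/k!` decrease in `k ≥ 1` because `(1 + 1/k)^k ≤ e`, and the first of
them is `1/e`. -/
theorem gammaDensity_self_le (m : ℕ) :
    gammaDensity (m + 1) (m + 1) ≤ Real.exp (-1) := by
  induction m with
  | zero => simp [gammaDensity]
  | succ m ih =>
    refine le_trans ?_ ih
    have h1 : (1 + 1 / (m + 1 : ℝ)) ^ (m + 1) ≤ Real.exp 1 := by
      have := Real.add_one_le_exp (1 / (m + 1 : ℝ))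
      calc (1 + 1 / (m + 1 : ℝ)) ^ (m + 1) ≤ Real.exp (1 / (m + 1 : ℝ)) ^ (m + 1) := by
            gcongr; linarith
        _ = Real.exp 1 := by
            rw [← Real.exp_nat_mul]; congr 1; push_cast; field_simp
    have h2 : (m + 1 + 1 : ℝ) ^ (m + 1) ≤ Real.exp 1 * (m + 1 : ℝ) ^ (m + 1) := by
      have : (m + 1 + 1 : ℝ) = (1 + 1 / (m + 1 : ℝ)) * (m + 1) := by field_simp
      rw [this, mul_pow]
      gcongr
    have h3 : Real.exp (-(m + 1 : ℝ)) = Real.exp (-(m + 1 + 1 : ℝ)) * Real.exp 1 := by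
      rw [← Real.exp_add]; congr 1; ring
    unfold gammaDensity
    rw [Nat.factorial_succ (m + 1), div_le_div_iff₀ (by positivity) (by positivity)]
    push_cast
    rw [pow_succ, h3]
    calc _ = (m + 1 + 1 : ℝ) ^ (m + 1) *
          ((m + 1 + 1) * Real.exp (-(m + 1 + 1 : ℝ)) * (m + 1).factorial) := by ring
      _ ≤ (Real.exp 1 * (m + 1 : ℝ) ^ (m + 1)) *
          ((m + 1 + 1) * Real.exp (-(m + 1 + 1 : ℝ)) * (m + 1).factorial) := by gcongr
      _ = _ := by ring

theorem gammaDensity_le_exp_neg_one (m : ℕ) {x : ℝ} (hx : 0 ≤ x) :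
    gammaDensity (m + 1) x ≤ Real.exp (-1) := by
  refine le_trans ?_ (gammaDensity_self_le m)
  have hm : (0 : ℝ) ≤ m + 1 := by positivity
  rcases le_total x (m + 1) with h | h
  · exact monotoneOn_gammaDensity m ⟨hx, h⟩ ⟨hm, le_rfl⟩ h
  · exact antitoneOn_gammaDensity m (Set.mem_Ici.2 le_rfl) h h

/-- Before the peak a value is at most the integral over the next unit interval, after it at most
that over the preceding one. Since `0 ≤ u ≤ 1`, the peak `m + 1` lies between `u + m` and `u + m +
1`. Of these two values the smaller is bounded by the integral between them and the larger by `1/e`.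
The integrals do not overlap, so they add up to at most 1. -/
theorem sum_gammaDensity_le (m N : ℕ) {u : ℝ} (hu0 : 0 ≤ u) (hu1 : u ≤ 1) :
    ∑ n ∈ Finset.range N, gammaDensity (m + 1) (u + n) ≤ 1 + Real.exp (-1) := by
  set g := gammaDensity (m + 1)
  have hgc : Continuous g := continuous_gammaDensity _
  have hgi : ∀ a b : ℝ, IntervalIntegrable g volume a b := fun a b => hgc.intervalIntegrable a b
  have hnn : ∀ x : ℝ, 0 ≤ x → 0 ≤ g x := fun x hx => gammaDensity_nonneg _ hx
  have hmono : MonotoneOn g (Set.Icc u (u + m)) := (monotoneOn_gammaDensity m).mono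
    (Set.Icc_subset_Icc hu0 (by linarith))
  have hanti : AntitoneOn g (Set.Icc (u + m + 1) (u + m + 1 + N)) :=
    (antitoneOn_gammaDensity m).mono fun x hx => by
      have := hx.1
      simp only [Set.mem_Ici]; linarith
  have h1 := hmono.sum_le_integral
  have h2 := hanti.sum_le_integral
  have hmid : min (g (u + m)) (g (u + m + 1)) ≤ ∫ x in (u + m)..(u + m + 1), g x := by
    have : ∫ _ in (u + m)..(u + m + 1), min (g (u + m)) (g (u + m + 1)) ≤
        ∫ x in (u + m)..(u + m + 1), g x := by
      refine intervalIntegral.integral_mono_on (by linarith) (by simp) (hgi _ _) fun x hx => ?_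
      have hm0 : (0 : ℝ) ≤ m := by positivity
      rcases le_total x (m + 1) with h | h
      · exact (min_le_left _ _).trans (monotoneOn_gammaDensity m ⟨by linarith, by linarith⟩
          ⟨by linarith [hx.1], h⟩ hx.1)
      · exact (min_le_right _ _).trans (antitoneOn_gammaDensity m h
          (Set.mem_Ici.2 (by linarith)) hx.2)
    simpa using this
  have hmax : max (g (u + m)) (g (u + m + 1)) ≤ Real.exp (-1) :=
    max_le (gammaDensity_le_exp_neg_one m (by positivity))
      (gammaDensity_le_exp_neg_one m (by positivity))
  have hpair : g (u + m) + g (u + m + 1) ≤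
      (∫ x in (u + m)..(u + m + 1), g x) + Real.exp (-1) := by
    rw [← min_add_max]
    exact add_le_add hmid hmax
  have htot : ∫ x in u..(u + m + 1 + N), g x ≤ 1 := by
    have hle : u ≤ u + m + 1 + N := by
      have : (0 : ℝ) ≤ m := by positivity
      have : (0 : ℝ) ≤ N := by positivity
      linarith
    rw [intervalIntegral.integral_of_le hle, ← integral_gammaDensity (m + 1)]
    refine setIntegral_mono_set (integrableOn_gammaDensity _)
      ((ae_restrict_iff' measurableSet_Ioi).2 (.of_forall fun x hx => hnn x (le_of_lt hx)))
      (LE.le.eventuallyLE fun x hx => ?_)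
    exact lt_of_le_of_lt hu0 hx.1
  -- Lengthening the range to `m + 2 + N` makes it split into `m` rising terms, the two around the
  -- peak, and `N` falling terms, whatever `N` is.
  calc ∑ n ∈ Finset.range N, g (u + n)
      ≤ ∑ n ∈ Finset.range (m + 2 + N), g (u + n) :=
        Finset.sum_le_sum_of_subset_of_nonneg (Finset.range_mono (by omega))
          fun n _ _ => hnn _ (by positivity)
    _ = ∑ n ∈ Finset.range m, g (u + n) + (g (u + m) + g (u + m + 1)) +
          ∑ n ∈ Finset.range N, g (u + m + 1 + (n + 1 : ℕ)) := by
        rw [Finset.sum_range_add, Finset.sum_range_succ, Finset.sum_range_succ, add_assoc (∑ _ ∈ _, _)]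
        congr 1
        · push_cast; rw [← add_assoc u]
        · refine Finset.sum_congr rfl fun n _ => ?_
          push_cast; ring_nf
    _ ≤ (∫ x in u..(u + m), g x) + ((∫ x in (u + m)..(u + m + 1), g x) + Real.exp (-1)) +
          ∫ x in (u + m + 1)..(u + m + 1 + N), g x := by gcongr
    _ = (∫ x in u..(u + m + 1 + N), g x) + Real.exp (-1) := by
        have e1 := intervalIntegral.integral_add_adjacent_intervals
          (hgi u (u + m)) (hgi _ (u + m + 1))
        have e2 := intervalIntegral.integral_add_adjacent_intervals
          (hgi u (u + m + 1)) (hgi _ (u + m + 1 + N))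
        linarith
    _ ≤ 1 + Real.exp (-1) := by gcongr

theorem tsum_gammaDensity_le (m : ℕ) {u : ℝ} (hu0 : 0 ≤ u) (hu1 : u ≤ 1) :
    ∑' n : ℕ, ENNReal.ofReal (gammaDensity (m + 1) (u + n)) ≤
      ENNReal.ofReal (1 + Real.exp (-1)) := by
  refine ENNReal.tsum_le_of_sum_range_le fun N => ?_
  rw [← ENNReal.ofReal_sum_of_nonneg fun n _ => gammaDensity_nonneg _ (by positivity)]
  exact ENNReal.ofReal_le_ofReal (sum_gammaDensity_le m N hu0 hu1)

/-! ### Moments of the equidistant intervals -/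

theorem div_pi_mem_equidistantIntervals {s x : ℝ} :
    x / Real.pi ∈ equidistantIntervals s ↔ x ∈ ⋃ n : ℕ, Set.Icc (n : ℝ) (n + s) := by
  have h : ∀ n : ℕ, x / Real.pi ∈ (fun x : ℝ => 1 / Real.pi * x) '' Set.Icc (n : ℝ) (n + s) ↔
      x ∈ Set.Icc (n : ℝ) (n + s) := by
    intro n
    have hinj : Function.Injective (fun x : ℝ => 1 / Real.pi * x) :=
      mul_right_injective₀ (by positivity)
    rw [show x / Real.pi = (fun x : ℝ => 1 / Real.pi * x) x by simp; ring, hinj.mem_set_image]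
  simp only [equidistantIntervals, Set.mem_iUnion, h]

theorem measurableSet_equidistantIntervals (s : ℝ) :
    MeasurableSet (equidistantIntervals s) := by
  refine MeasurableSet.iUnion fun n => IsCompact.measurableSet ?_
  exact isCompact_Icc.image (by fun_prop)

theorem radialMoment_equidistantIntervals (s : ℝ) (k : ℕ) :
    radialMoment (equidistantIntervals s) k =
      ∫⁻ x in Set.Ioi 0 ∩ ⋃ n : ℕ, Set.Icc (n : ℝ) (n + s), ENNReal.ofReal (gammaDensity k x) := by
  rw [radialMoment, Set.inter_comm,
    ← setLIntegral_indicator (MeasurableSet.iUnion fun n => measurableSet_Icc)]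
  refine lintegral_congr fun x => ?_
  by_cases hx : x ∈ ⋃ n : ℕ, Set.Icc (n : ℝ) (n + s)
  · rw [Set.indicator_of_mem hx, Set.indicator_of_mem (div_pi_mem_equidistantIntervals.2 hx)]
    simp
  · rw [Set.indicator_of_notMem hx,
      Set.indicator_of_notMem (mt div_pi_mem_equidistantIntervals.1 hx), zero_mul]

theorem radialMoment_equidistantIntervals_le_tsum (s : ℝ) (k : ℕ) :
    radialMoment (equidistantIntervals s) k ≤
      ∑' n : ℕ, ∫⁻ x in Set.Icc (n : ℝ) (n + s), ENNReal.ofReal (gammaDensity k x) := by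
  rw [radialMoment_equidistantIntervals]
  exact (lintegral_mono_set Set.inter_subset_right).trans (lintegral_iUnion_le _ _)

/-- Translating all intervals onto `[0, s]` leaves the integral over `u` of the lattice sum at `u`,
which is bounded uniformly. -/
theorem radialMoment_equidistantIntervals_succ_le {s : ℝ} (hs1 : s ≤ 1) (m : ℕ) :
    radialMoment (equidistantIntervals s) (m + 1) ≤
      ENNReal.ofReal ((1 + Real.exp (-1)) * s) := by
  have hc := continuous_gammaDensity (m + 1)
  have hshift : ∀ n : ℕ, ∫⁻ x in Set.Icc (n : ℝ) (n + s),
      ENNReal.ofReal (gammaDensity (m + 1) x) =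
      ∫⁻ u in Set.Icc 0 s, ENNReal.ofReal (gammaDensity (m + 1) (u + n)) := by
    intro n
    have := (measurePreserving_add_right volume (n : ℝ)).setLIntegral_comp_preimage
      (s := Set.Icc (n : ℝ) (n + s)) measurableSet_Icc
      (f := fun x => ENNReal.ofReal (gammaDensity (m + 1) x)) (by fun_prop)
    rw [← this]
    simp [add_comm]
  calc _ ≤ _ := radialMoment_equidistantIntervals_le_tsum s (m + 1)
    _ = ∫⁻ u in Set.Icc 0 s, ∑' n : ℕ, ENNReal.ofReal (gammaDensity (m + 1) (u + n)) := by
        simp_rw [hshift]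
        rw [lintegral_tsum fun n => by fun_prop]
    _ ≤ ∫⁻ _ in Set.Icc 0 s, ENNReal.ofReal (1 + Real.exp (-1)) :=
        setLIntegral_mono measurable_const fun u hu =>
          tsum_gammaDensity_le m hu.1 (hu.2.trans hs1)
    _ = ENNReal.ofReal ((1 + Real.exp (-1)) * s) := by
        rw [setLIntegral_const, Real.volume_Icc, sub_zero, ENNReal.ofReal_mul (by positivity)]

theorem lintegral_Ioc_gammaDensity_zero {a b : ℝ} (hab : a ≤ b) :
    ∫⁻ x in Set.Ioc a b, ENNReal.ofReal (gammaDensity 0 x) =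
      ENNReal.ofReal (Real.exp (-a) - Real.exp (-b)) := by
  have hc := continuous_gammaDensity 0
  rw [← ofReal_integral_eq_lintegral_ofReal, ← intervalIntegral.integral_of_le hab]
  · simp [gammaDensity]
  · exact hc.integrableOn_Icc.mono_set Set.Ioc_subset_Icc_self
  · exact .of_forall fun x => by simp [gammaDensity]; positivity

theorem tsum_lintegral_gammaDensity_zero {s : ℝ} (hs : 0 ≤ s) :
    ∑' n : ℕ, ∫⁻ x in Set.Ioc (n : ℝ) (n + s), ENNReal.ofReal (gammaDensity 0 x) =
      ENNReal.ofReal ((1 - Real.exp (-s)) * (Real.exp 1 / (Real.exp 1 - 1))) := by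
  have hs' : Real.exp (-s) ≤ 1 := Real.exp_le_one_iff.2 (by linarith)
  have hterm : ∀ n : ℕ, ∫⁻ x in Set.Ioc (n : ℝ) (n + s), ENNReal.ofReal (gammaDensity 0 x) =
      ENNReal.ofReal ((1 - Real.exp (-s)) * Real.exp (-1) ^ n) := by
    intro n
    rw [lintegral_Ioc_gammaDensity_zero (by linarith), ← Real.exp_nat_mul, neg_add, Real.exp_add]
    congr 1
    ring_nf
  have hgeo := (hasSum_geometric_of_lt_one (Real.exp_pos (-1)).le
    (Real.exp_lt_one_iff.2 (by norm_num))).mul_left (1 - Real.exp (-s))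
  simp_rw [hterm]
  rw [← ENNReal.ofReal_tsum_of_nonneg (fun n => mul_nonneg (by linarith) (by positivity))
    hgeo.summable, hgeo.tsum_eq]
  congr 2
  have h1 : 1 < Real.exp 1 := Real.one_lt_exp_iff.2 one_pos
  have h2 : Real.exp 1 - 1 ≠ 0 := by linarith
  rw [Real.exp_neg]
  field_simp

/-- The upper bound is subadditivity over closed intervals. The lower bound uses half-open ones,
which avoid 0 and remain disjoint at `s = 1`, where closed neighbours share an endpoint. -/
theorem radialMoment_equidistantIntervals_zero {s : ℝ} (hs0 : 0 ≤ s) (hs1 : s ≤ 1) :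
    radialMoment (equidistantIntervals s) 0 =
      ENNReal.ofReal ((1 - Real.exp (-s)) * (Real.exp 1 / (Real.exp 1 - 1))) := by
  rw [← tsum_lintegral_gammaDensity_zero hs0]
  apply le_antisymm
  · refine (radialMoment_equidistantIntervals_le_tsum s 0).trans_eq (tsum_congr fun n => ?_)
    exact setLIntegral_congr Ioc_ae_eq_Icc.symm
  · rw [radialMoment_equidistantIntervals, ← lintegral_iUnion (fun n => measurableSet_Ioc)]
    · refine lintegral_mono_set fun x hx => ?_
      obtain ⟨n, hn⟩ := Set.mem_iUnion.1 hx
      exact ⟨lt_of_le_of_lt (by positivity) hn.1, Set.mem_iUnion.2 ⟨n, hn.1.le, hn.2⟩⟩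
    · intro i j hij
      rw [Function.onFun, Set.disjoint_left]
      rintro x ⟨h1, h2⟩ ⟨h3, h4⟩
      apply hij
      have h5 : (i : ℝ) < j + 1 := by linarith
      have h6 : (j : ℝ) < i + 1 := by linarith
      norm_cast at h5 h6
      omega

/-! ### The quadratic form: Gaussian mode and upper bound -/

/-- The Gaussian is the mode `k = 0`: its entire factor may be taken to be the constant 1. -/
theorem norm_stft_gaussianWindow_self (ω t : ℝ) :
    ‖stft gaussianWindow gaussianWindow (ω, t)‖ =
      Real.exp (-(Real.pi / 2) * (ω ^ 2 + t ^ 2)) := by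
  have hpi := Real.pi_pos
  set w : ℂ := t - ω * Complex.I with hw
  have h1 : gaussianLaplace gaussianWindow w = ((2 : ℝ) ^ (1 / 4 : ℝ) : ℝ) *
      ((Real.pi / -(-(2 * Real.pi))) ^ (1 / 2 : ℂ) *
        Complex.exp (0 - (2 * Real.pi * w) ^ 2 / (4 * -(2 * Real.pi)))) := by
    have hre : (-(2 * Real.pi : ℂ)).re < 0 := by simp [hpi]
    rw [← integral_cexp_quadratic hre, gaussianLaplace, ← integral_const_mul]
    refine integral_congr_ae (.of_forall fun x => ?_)
    simp only [gaussianWindow]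
    push_cast
    rw [mul_assoc, ← Complex.exp_add]
    congr 2
    ring
  have h2 : (0 - (2 * Real.pi * w) ^ 2 / (4 * -(2 * Real.pi)) : ℂ) =
      ((Real.pi / 2 : ℝ) : ℂ) * w ^ 2 := by
    have : (Real.pi : ℂ) ≠ 0 := by exact_mod_cast hpi.ne'
    push_cast
    field_simp
    ring
  have h3 : (((Real.pi / 2 : ℝ) : ℂ) * w ^ 2).re = Real.pi / 2 * (t ^ 2 - ω ^ 2) := by
    rw [Complex.re_ofReal_mul]
    congr 1
    simp [hw, pow_two]
  have h4 : ((Real.pi / -(-(2 * Real.pi))) ^ (1 / 2 : ℂ) : ℂ) =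
      (((1 / 2 : ℝ) ^ (1 / 2 : ℝ) : ℝ) : ℂ) := by
    rw [Complex.ofReal_cpow (by norm_num)]
    have : (Real.pi : ℂ) ≠ 0 := by exact_mod_cast hpi.ne'
    congr 1
    · push_cast
      field_simp
    · push_cast; rfl
  have h5 : (2 : ℝ) ^ (1 / 4 : ℝ) * (2 : ℝ) ^ (1 / 4 : ℝ) * (1 / 2 : ℝ) ^ (1 / 2 : ℝ) = 1 := by
    rw [← Real.rpow_add (by norm_num), show (1 / 4 : ℝ) + 1 / 4 = 1 / 2 by norm_num,
      ← Real.mul_rpow (by norm_num) (by norm_num)]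
    norm_num
  rw [stft_gaussianWindow_eq, h1, h2, h4, norm_mul, norm_mul, norm_mul, Complex.norm_exp, h3,
    Complex.norm_real, Complex.norm_real, Complex.norm_real, Real.norm_of_nonneg (by positivity),
    Real.norm_of_nonneg (by positivity), Real.norm_of_nonneg (by positivity),
    show -(Real.pi / 2) * (ω ^ 2 + t ^ 2) = -Real.pi * t ^ 2 + Real.pi / 2 * (t ^ 2 - ω ^ 2) by
      ring, Real.exp_add]
  linear_combination (Real.exp (-Real.pi * t ^ 2) *
    Real.exp (Real.pi / 2 * (t ^ 2 - ω ^ 2))) * h5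

theorem lintegral_radial_mul_sq_norm_stft_self {E : Set ℝ} (hE : MeasurableSet E) :
    ∫⁻ z : ℝ × ℝ, E.indicator 1 (z.1 ^ 2 + z.2 ^ 2) *
      ENNReal.ofReal (‖stft gaussianWindow gaussianWindow z‖ ^ 2) = radialMoment E 0 := by
  rw [lintegral_radial_mul_sq_norm (H := fun _ => 1) (a := fun k => if k = 0 then 1 else 0)
    continuous_const (fun ω t => by rw [norm_stft_gaussianWindow_self, norm_one, mul_one])
    (fun z => ?_) hE]
  · rw [tsum_eq_single 0 fun k hk => by simp [hk]]
    simp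
  · convert! hasSum_ite_eq 0 (1 : ℂ) using 2 with k
    by_cases hk : k = 0 <;> simp [hk]

/-- Compare the expansions for `E` and for the whole line: they have the same coefficients, and all
moments of the latter are 1. -/
theorem lintegral_radial_mul_sq_norm_stft_le (f : L2R) {E : Set ℝ} (hE : MeasurableSet E)
    {M : ENNReal} (hM : ∀ k, radialMoment E k ≤ M) :
    ∫⁻ z : ℝ × ℝ, E.indicator 1 (z.1 ^ 2 + z.2 ^ 2) *
      ENNReal.ofReal (‖stft gaussianWindow f z‖ ^ 2) ≤ M * ENNReal.ofReal (‖f‖ ^ 2) := by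
  obtain ⟨H, hH, hV⟩ := exists_entire_norm_stft_gaussianWindow (Lp.memLp f)
  obtain ⟨a, ha⟩ := exists_hasSum_pow_of_differentiable hH
  have huniv := lintegral_radial_mul_sq_norm hH.continuous hV ha MeasurableSet.univ
  simp only [Set.indicator_univ, Pi.one_apply, one_mul, radialMoment_univ, mul_one] at huniv
  rw [lintegral_radial_mul_sq_norm hH.continuous hV ha hE]
  calc _ ≤ ∑' k, ENNReal.ofReal (‖a k‖ ^ 2 * k.factorial / Real.pi ^ k) * M := by
        gcongr with k
        exact hM k
    _ = M * ∫⁻ z : ℝ × ℝ, ENNReal.ofReal (‖stft gaussianWindow f z‖ ^ 2) := by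
        rw [ENNReal.tsum_mul_right, huniv, mul_comm]
    _ ≤ _ := by
        gcongr
        exact lintegral_sq_norm_stft_le f

/-! ### The localization operator as `T*T` -/

theorem ofReal_sq_norm_sphericalWeight_mul (E : Set ℝ) (z : ℝ × ℝ) (c : ℂ) :
    ENNReal.ofReal (‖sphericalWeight E z * c‖ ^ 2) =
      E.indicator 1 (z.1 ^ 2 + z.2 ^ 2) * ENNReal.ofReal (‖c‖ ^ 2) := by
  by_cases h : z.1 ^ 2 + z.2 ^ 2 ∈ E <;> simp [sphericalWeight, h]

theorem measurable_sphericalWeight {E : Set ℝ} (hE : MeasurableSet E) :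
    Measurable (sphericalWeight E) :=
  (measurable_const.indicator hE).comp
    (f := fun z : ℝ × ℝ => z.1 ^ 2 + z.2 ^ 2) (by fun_prop)

theorem memLp_sphericalWeight_mul_stft {E : Set ℝ} (hE : MeasurableSet E) (f : L2R) :
    MemLp (fun z => sphericalWeight E z * stft gaussianWindow f z) 2 volume := by
  have hm : AEStronglyMeasurable (fun z => sphericalWeight E z * stft gaussianWindow f z)
      volume :=
    ((measurable_sphericalWeight hE).mul
      (continuous_stft_gaussianWindow (Lp.memLp f)).measurable).aestronglyMeasurable
  rw [memLp_two_iff_integrable_sq_norm hm]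
  refine ⟨hm.norm.pow 2, ?_⟩
  rw [hasFiniteIntegral_iff_ofReal (.of_forall fun _ => by positivity)]
  simp_rw [ofReal_sq_norm_sphericalWeight_mul]
  refine (lintegral_radial_mul_sq_norm_stft_le f hE (radialMoment_le_one E)).trans_lt ?_
  rw [one_mul]
  exact ENNReal.ofReal_lt_top

/-- The Gaussian short-time Fourier transform followed by multiplication with the indicator
of `ω² + t² ∈ E`, as a linear map from `L²(ℝ)` to `L²(ℝ²)`. -/
noncomputable def restrictedStftLinear {E : Set ℝ} (hE : MeasurableSet E) :
    L2R →ₗ[ℂ] Lp ℂ 2 (volume : Measure (ℝ × ℝ)) where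
  toFun f := (memLp_sphericalWeight_mul_stft hE f).toLp _
  map_add' f g := by
    rw [← MemLp.toLp_add]
    congr 1
    ext z
    rw [stft_congr_ae (Lp.coeFn_add f g), stft_gaussianWindow_add (Lp.memLp f) (Lp.memLp g),
      mul_add, Pi.add_apply]
  map_smul' c f := by
    rw [RingHom.id_apply, ← MemLp.toLp_const_smul]
    congr 1
    ext z
    rw [stft_congr_ae (Lp.coeFn_smul c f), stft_const_smul, Pi.smul_apply, smul_eq_mul]
    ring

theorem ofReal_sq_norm_restrictedStftLinear {E : Set ℝ} (hE : MeasurableSet E) (f : L2R) :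
    ENNReal.ofReal (‖restrictedStftLinear hE f‖ ^ 2) =
      ∫⁻ z : ℝ × ℝ, E.indicator 1 (z.1 ^ 2 + z.2 ^ 2) *
        ENNReal.ofReal (‖stft gaussianWindow f z‖ ^ 2) := by
  rw [← lintegral_sq_norm_eq_ofReal_sq_norm]
  refine lintegral_congr_ae ?_
  filter_upwards [(memLp_sphericalWeight_mul_stft hE f).coeFn_toLp] with z hz
  rw [← ofReal_sq_norm_sphericalWeight_mul, ← hz]
  rfl

theorem sq_norm_restrictedStftLinear_le {E : Set ℝ} (hE : MeasurableSet E) (f : L2R) {M : ℝ}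
    (hM0 : 0 ≤ M) (hM : ∀ k, radialMoment E k ≤ ENNReal.ofReal M) :
    ‖restrictedStftLinear hE f‖ ^ 2 ≤ M * ‖f‖ ^ 2 := by
  rw [← ENNReal.ofReal_le_ofReal_iff (by positivity), ofReal_sq_norm_restrictedStftLinear,
    ENNReal.ofReal_mul hM0]
  exact lintegral_radial_mul_sq_norm_stft_le f hE hM

theorem norm_restrictedStftLinear_le {E : Set ℝ} (hE : MeasurableSet E) (f : L2R) {M : ℝ}
    (hM0 : 0 ≤ M) (hM : ∀ k, radialMoment E k ≤ ENNReal.ofReal M) :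
    ‖restrictedStftLinear hE f‖ ≤ √M * ‖f‖ := by
  refine Real.le_sqrt_of_sq_le (sq_norm_restrictedStftLinear_le hE f hM0 hM) |>.trans_eq ?_
  rw [Real.sqrt_mul hM0, Real.sqrt_sq (norm_nonneg _)]

/-- The bounded operator underlying `restrictedStftLinear`. -/
noncomputable def restrictedStft {E : Set ℝ} (hE : MeasurableSet E) :
    L2R →L[ℂ] Lp ℂ 2 (volume : Measure (ℝ × ℝ)) :=
  (restrictedStftLinear hE).mkContinuous (√1) fun f =>
    norm_restrictedStftLinear_le hE f zero_le_one fun k => by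
      simpa using radialMoment_le_one E k

/-- The weight is real and equal to its square, so cutting off both transforms produces it exactly
once in the inner product. -/
theorem isLocalizationOperator_adjoint_comp {E : Set ℝ} (hE : MeasurableSet E) :
    IsLocalizationOperator (sphericalWeight E) gaussianWindow
      ((restrictedStft hE).adjoint ∘L restrictedStft hE) := by
  intro f g
  have hpt : (fun z => inner ℂ (restrictedStft hE g z) (restrictedStft hE f z)) =ᵐ[volume]
      locIntegrand (sphericalWeight E) gaussianWindow f g := by
    filter_upwards [(memLp_sphericalWeight_mul_stft hE f).coeFn_toLp,
      (memLp_sphericalWeight_mul_stft hE g).coeFn_toLp] with z hf hg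
    have hf' : restrictedStft hE f z = sphericalWeight E z * stft gaussianWindow f z := hf
    have hg' : restrictedStft hE g z = sphericalWeight E z * stft gaussianWindow g z := hg
    rw [hf', hg', RCLike.inner_apply, locIntegrand]
    by_cases h : z.1 ^ 2 + z.2 ^ 2 ∈ E <;> simp [sphericalWeight, h]
  refine ⟨(L2.integrable_inner _ _).congr hpt, ?_⟩
  rw [ContinuousLinearMap.comp_apply, ContinuousLinearMap.adjoint_inner_right, L2.inner_def]
  exact integral_congr_ae hpt

/-- Existence rules out the default value 0, and uniqueness identifies the chosen operator with
`T*T`. -/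
theorem sphericalLocalization_eq {E : Set ℝ} (hE : MeasurableSet E) :
    IsLocalizationOperator (sphericalWeight E) gaussianWindow (sphericalLocalization E) ∧
      sphericalLocalization E = (restrictedStft hE).adjoint ∘L restrictedStft hE := by
  have h : ∃ P, IsLocalizationOperator (sphericalWeight E) gaussianWindow P :=
    ⟨_, isLocalizationOperator_adjoint_comp hE⟩
  have h1 : IsLocalizationOperator (sphericalWeight E) gaussianWindow
      (sphericalLocalization E) := by
    rw [sphericalLocalization, localizationOperator, dif_pos h]
    exact h.choose_spec
  exact ⟨h1, h1.unique (isLocalizationOperator_adjoint_comp hE)⟩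

theorem norm_sphericalLocalization_le {E : Set ℝ} (hE : MeasurableSet E) {M : ℝ} (hM0 : 0 ≤ M)
    (hM : ∀ k, radialMoment E k ≤ ENNReal.ofReal M) : ‖sphericalLocalization E‖ ≤ M := by
  have h : ‖restrictedStft hE‖ ≤ √M :=
    ContinuousLinearMap.opNorm_le_bound _ (Real.sqrt_nonneg _) fun f =>
      norm_restrictedStftLinear_le hE f hM0 hM
  rw [(sphericalLocalization_eq hE).2, ContinuousLinearMap.norm_adjoint_comp_self]
  calc _ ≤ √M * √M := by gcongr
    _ = M := Real.mul_self_sqrt hM0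

/-- Evaluate `T` on the unit-norm Gaussian and use `‖T*T‖ = ‖T‖²`. -/
theorem radialMoment_zero_le_norm_sphericalLocalization {E : Set ℝ} (hE : MeasurableSet E) :
    radialMoment E 0 ≤ ENNReal.ofReal ‖sphericalLocalization E‖ := by
  have hφ : MemLp gaussianWindow 2 volume := by simpa using memLp_gaussianWindow_sub 0
  set φ : L2R := hφ.toLp
  have hae : φ =ᵐ[volume] gaussianWindow := hφ.coeFn_toLp
  have hnorm : ‖φ‖ = 1 := by
    have h1 := integral_norm_gaussianWindow_sub_sq 0
    simp only [sub_zero] at h1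
    have h2 := integral_sq_norm_eq_sq_norm φ
    have h3 : ∫ x, ‖φ x‖ ^ 2 = ∫ x, ‖gaussianWindow x‖ ^ 2 :=
      integral_congr_ae (hae.fun_comp fun c => ‖c‖ ^ 2)
    rw [h3, h1] at h2
    exact (sq_eq_sq₀ (norm_nonneg _) zero_le_one).1 (by rw [← h2, one_pow])
  have h := ofReal_sq_norm_restrictedStftLinear hE φ
  rw [stft_congr_ae hae, lintegral_radial_mul_sq_norm_stft_self hE] at h
  rw [← h, (sphericalLocalization_eq hE).2, ContinuousLinearMap.norm_adjoint_comp_self, ← sq]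
  gcongr
  have hle := (restrictedStft hE).le_opNorm φ
  rw [hnorm, mul_one] at hle
  exact hle

end TimeFrequency

/-! ### The main theorem -/

open TimeFrequency

theorem mainTheorem5 :
    (∀ s : ℝ, s ∈ Set.Icc (0 : ℝ) 1 →
      TimeFrequency.IsLocalizationOperator
          (TimeFrequency.sphericalWeight (TimeFrequency.equidistantIntervals s))
          TimeFrequency.gaussianWindow
          (TimeFrequency.sphericalLocalization (TimeFrequency.equidistantIntervals s)) ∧
        (1 - Real.exp (-s)) * (Real.exp 1 / (Real.exp 1 - 1)) ≤
          ‖TimeFrequency.sphericalLocalization (TimeFrequency.equidistantIntervals s)‖ ∧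
        ‖TimeFrequency.sphericalLocalization (TimeFrequency.equidistantIntervals s)‖ ≤
          min (Real.exp 1 / (Real.exp 1 - 1) * s) 1) ∧
    ∃ s₀ : ℝ, 0 < s₀ ∧ s₀ ≤ 1 ∧ ∀ s : ℝ, 0 < s → s < s₀ →
      ‖TimeFrequency.sphericalLocalization (TimeFrequency.equidistantIntervals s)‖ =
        (1 - Real.exp (-s)) * (Real.exp 1 / (Real.exp 1 - 1)) := by
  have he1 := Real.exp_one_gt_d9
  have he2 := Real.exp_one_lt_d9
  set C := Real.exp 1 / (Real.exp 1 - 1) with hC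
  -- The argument rests on the gap between `1 + 1/e ≤ 1.37` and `C ≥ 1.58`.
  have hC1 : 1.58 ≤ C := by
    rw [hC, le_div_iff₀ (by linarith)]
    linarith
  have hinv : Real.exp (-1) ≤ 0.37 := by
    rw [Real.exp_neg, inv_le_comm₀ (by positivity) (by norm_num)]
    linarith
  have hlower : ∀ s ∈ Set.Icc (0 : ℝ) 1, (1 - Real.exp (-s)) * C ≤
      ‖sphericalLocalization (equidistantIntervals s)‖ := by
    intro s hs
    rw [← ENNReal.ofReal_le_ofReal_iff (norm_nonneg _),
      ← radialMoment_equidistantIntervals_zero hs.1 hs.2]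
    exact radialMoment_zero_le_norm_sphericalLocalization (measurableSet_equidistantIntervals s)
  have hexp : ∀ s : ℝ, 1 - Real.exp (-s) ≤ s := fun s => by
    linarith [Real.add_one_le_exp (-s)]
  -- The choice `s₀ = 1/4` works because `1.37 s ≤ 1.58 (s - s²/2)` holds for `0 ≤ s ≤ 2(1 -
  -- 1.37/1.58) ≈ 0.266`.
  refine ⟨fun s hs => ⟨(sphericalLocalization_eq (measurableSet_equidistantIntervals s)).1,
    hlower s hs, le_min ?_ ?_⟩, 1 / 4, by norm_num, by norm_num, fun s hs0 hs1 => ?_⟩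
  · refine norm_sphericalLocalization_le (measurableSet_equidistantIntervals s)
      (mul_nonneg (by linarith) hs.1) fun k => ?_
    cases k with
    | zero =>
      rw [radialMoment_equidistantIntervals_zero hs.1 hs.2, ← hC]
      refine ENNReal.ofReal_le_ofReal ?_
      rw [mul_comm C]
      exact mul_le_mul_of_nonneg_right (hexp s) (by linarith)
    | succ m =>
      refine (radialMoment_equidistantIntervals_succ_le hs.2 m).trans
        (ENNReal.ofReal_le_ofReal ?_)
      exact mul_le_mul_of_nonneg_right (by linarith) hs.1
  · refine norm_sphericalLocalization_le (measurableSet_equidistantIntervals s) zero_le_one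
      fun k => ?_
    rw [ENNReal.ofReal_one]
    exact radialMoment_le_one _ k
  · have hs : s ∈ Set.Icc (0 : ℝ) 1 := ⟨hs0.le, by linarith⟩
    -- From `e^s ≥ 1 + s + s²/2` and `(1 - s + s²/2)(1 + s + s²/2) = 1 + s⁴/4 ≥ 1`.
    have hq : s - s ^ 2 / 2 ≤ 1 - Real.exp (-s) := by
      have h1 := Real.quadratic_le_exp_of_nonneg hs0.le
      have h2 : Real.exp (-s) * Real.exp s = 1 := by rw [← Real.exp_add]; simp
      have h3 := Real.exp_pos (-s)
      have h4 : Real.exp (-s) * (1 + s + s ^ 2 / 2) ≤ 1 := by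
        exact (mul_le_mul_of_nonneg_left h1 h3.le).trans_eq h2
      have h5 : 1 ≤ (1 - s + s ^ 2 / 2) * (1 + s + s ^ 2 / 2) := by
        nlinarith [sq_nonneg (s ^ 2)]
      have h6 : 0 < 1 + s + s ^ 2 / 2 := by positivity
      have h7 := le_of_mul_le_mul_right (h4.trans h5) h6
      linarith
    refine le_antisymm ?_ (hlower s hs)
    refine norm_sphericalLocalization_le (measurableSet_equidistantIntervals s)
      (mul_nonneg (by nlinarith) (by linarith)) fun k => ?_
    cases k with
    | zero => rw [radialMoment_equidistantIntervals_zero hs.1 hs.2]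
    | succ m =>
      refine (radialMoment_equidistantIntervals_succ_le hs.2 m).trans
        (ENNReal.ofReal_le_ofReal ?_)
      calc (1 + Real.exp (-1)) * s ≤ 1.37 * s := by gcongr; linarith
        _ ≤ (s - s ^ 2 / 2) * 1.58 := by nlinarith
        _ ≤ (1 - Real.exp (-s)) * C := by
          have : 0 ≤ s - s ^ 2 / 2 := by nlinarith
          exact mul_le_mul hq hC1 (by norm_num) (this.trans hq)
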